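/- Let $T>0$, let $W$ be a standard one-dimensional Brownian motion on $[0,T]$ and fix $t\in(0,T]$. **Conventions.** For measurable $f:\mathbb R\to\mathbb R$ put $$\overline{\alpha_f}=\inf\Big\{\alpha>0:\limsup_{|x|\to\infty}\frac{|f(x)|}{|x|^\alpha}<\infty\Big\},\qquad \underline{\alpha_f}=\inf\Big\{\alpha>0:\liminf_{|x|\to\infty}\frac{|f(x)|}{|x|^\alpha}<\infty\Big\}\qquad(\inf\emptyset=+\infty).$$ For a function $u(s,x)$ on $[0,T]\times\mathbb R$, $\alpha\ge 0$ and $\varepsilon>0$, and for $a>0$, put $$C_{\varepsilon,u,\alpha}=\sup_{x\in\mathbb R,\,s\in[0,T]}\frac{|u(s,x)|}{1+|x|^{\alpha+\varepsilon}}\in[0,\infty],\quad \delta_a=\max(1,2^a),\quad \Xi_a=\frac{a\,\Gamma(\frac{1+a}{2})}{2\sqrt\pi},\quad \mu(a)=\int_{\mathbb R}\frac{e^{-z^2/2}}{\sqrt{2\pi}\,(1+|z|^{a})}\,dz,$$ $$D_a=\max\Big(1+\delta_a\Xi_a+\tfrac{\delta_a^2}{2}\big(\Xi_a+(1+a)^{-1}\big)^2,\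 \tfrac12+\tfrac{\delta_a}{1+a}\Big).$$ **Assumptions.** Let $v:[0,T]\times\mathbb R\to\mathbb R$ be of class $\mathcal C^{1,1}$ (the partial derivatives in time and in space exist and are continuous on $[0,T]\times\mathbb R$). Write $v'$ for the derivative in space. Assume that $v'>0$ on $[0,T]\times\mathbb R$ and that for every $s\in[0,T]$ the function $v(s,\cdot)$ is unbounded from above and from below; let $v^{(-1)}(s,\cdot):\mathbb R\to\mathbb R$ be its inverse function. The growth rates $\underline{\alpha_v},\overline{\alpha_{v'}},\overline{\alpha_{v^{(-1)}}}$ are those of $v(t,\cdot)$, $v'(t,\cdot)$, $v^{(-1)}(t,\cdot)$ at the fixed time $t$. Assume that $P_t:=v(t,W_t)$ is integrable, that $\underline{\alpha_v}\in(0,\infty)$ and $\overline{\alpha_{v'}}<\infty$, that for some $\tilde\alpha>0$ and $K>0$ $$\frac1{v'(t,x)}\le K(1+|x|^{\tilde\alpha})\quad\text{for all }x\in\mathbb R,$$ and moreover that $0\le\overline{\alpha_{v'}}<\underline{\alpha_v}<+\infty$. **Conclusion.** Then $\overline{\alpha_{v^{(-1)}}}<\infty$, the law of $P_t$ has a continuous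 density $\rho_t$ with respect to the Lebesgue measure, and there exist $\varepsilon_0,\varepsilon_0'>0$, $y_0>0$ and $\gamma\in(0,1)$ such that, with $$M'=C_{\varepsilon_0,v',\overline{\alpha_{v'}}}^2\,D_{\overline{\alpha_{v'}}+\varepsilon_0}\Big(1+C_{\varepsilon_0',v^{(-1)},\overline{\alpha_{v^{(-1)}}}}^{2(\overline{\alpha_{v'}}+\varepsilon_0)}\Big)\delta_{2(\overline{\alpha_{v'}}+\varepsilon_0)},\qquad M=\frac{\mu(\tilde\alpha)}{K^2\Big(1+C_{\varepsilon_0',v^{(-1)},\overline{\alpha_{v^{(-1)}}}}^{2\tilde\alpha}\,\delta_{2\tilde\alpha}\Big)},\qquad p=\tilde\alpha\big(\overline{\alpha_{v^{(-1)}}}+\varepsilon_0'\big),$$ for all $y$ with $|y|>y_0$: $$\rho_t(y)\le\frac{\mathbb E|P_t-\mathbb E P_t|}{2Mt}\big(1+|y|^{2p}\big)\exp\Big(-\frac{|y-\mathbb E P_t|^{2(1-\gamma)}-|y_0-\mathbb E P_t|^{2(1-\gamma)}}{4(1-\gamma)\,t\,M'}\Big)$$ and $$\rho_t(y)\ge\frac{\mathbb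 E|P_t-\mathbb E P_t|}{2M't\,(1+|y|^{\gamma})}\exp\Big(-\frac{|y-\mathbb E P_t|^{2(p+1)}-|y_0-\mathbb E P_t|^{2(p+1)}}{M\,t\,(p+1)}\Big)\exp\Big(-\frac{|y_0-\mathbb E P_t|^2}{Mt}\big(1+y_0^{2p}\big)\Big).$$ (If one of the suprema $C$ is infinite, the bounds are read in $[0,\infty]$: $1/M'=0$ if $M'=\infty$, so that the lower bound is then $0$; and $M=0$, $1/M=\infty$ if the supremum for $v^{(-1)}$ is infinite, so that the upper bound is then $+\infty$.) -/

import Mathlib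

open Set Filter MeasureTheory ProbabilityTheory
open scoped NNReal ENNReal Topology

noncomputable section

namespace DensityTails

/-- `W` is a standard one-dimensional Brownian motion on `[0, T]`: its finite-dimensional laws at
times in `[0, T]` are those of Brownian motion, and almost all of its paths are continuous on
`[0, T]`. Values of `W` at times outside `[0, T]` play no role. -/
structure IsBrownianUpTo {Ω : Type*} [MeasurableSpace Ω] (T : ℝ≥0) (W : ℝ≥0 → Ω → ℝ)
    (P : Measure Ω) : Prop where
  hasLaw : ∀ I : Finset ℝ≥0, (∀ s ∈ I, s ≤ T) →
    HasLaw (fun ω ↦ I.restrict (W · ω)) (BrownianReal.projectiveFamily I) P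
  cont : ∀ᵐ ω ∂P, ContinuousOn (W · ω) (Iic T)

/-- `v` is of class `C^{1,1}` on `[0, T] × ℝ`: differentiable in time (one-sidedly at the two end
points) and in space, with both partial derivatives continuous in `(t, x)`. -/
structure IsC11 (T : ℝ) (v : ℝ → ℝ → ℝ) : Prop where
  diff_time : ∀ x, DifferentiableOn ℝ (fun s ↦ v s x) (Icc 0 T)
  diff_space : ∀ s ∈ Icc 0 T, Differentiable ℝ (v s)
  cont_time : ContinuousOn (fun p : ℝ × ℝ ↦ derivWithin (fun s ↦ v s p.2) (Icc 0 T) p.1)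
    (Icc 0 T ×ˢ univ)
  cont_space : ContinuousOn (fun p : ℝ × ℝ ↦ deriv (v p.1) p.2) (Icc 0 T ×ˢ univ)

/-- The space derivative `v'(t, x)`. -/
def spaceDeriv (v : ℝ → ℝ → ℝ) : ℝ → ℝ → ℝ := fun t x ↦ deriv (v t) x

/-- The space inverse: `spaceInv v t` is the inverse function of the bijection `v t`. -/
def spaceInv (v : ℝ → ℝ → ℝ) : ℝ → ℝ → ℝ := fun t ↦ Function.invFun (v t)

/-- The filter `|x| → +∞` on the real line. -/
def absInfty : Filter ℝ := comap (fun x : ℝ ↦ |x|) atTop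

/-- The upper growth rate
`inf {α > 0 : limsup_{|x| → ∞} |f x / x ^ α| < ∞}`, equal to `∞` if there is no such `α`. -/
def upperRate (f : ℝ → ℝ) : ℝ≥0∞ :=
  sInf (ENNReal.ofReal '' {α : ℝ | 0 < α ∧
    limsup (fun x ↦ ENNReal.ofReal (|f x| / |x| ^ α)) absInfty < ⊤})

/-- The lower growth rate
`inf {α > 0 : liminf_{|x| → ∞} |f x / x ^ α| < ∞}`, equal to `∞` if there is no such `α`. -/
def lowerRate (f : ℝ → ℝ) : ℝ≥0∞ :=
  sInf (ENNReal.ofReal '' {α : ℝ | 0 < α ∧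
    liminf (fun x ↦ ENNReal.ofReal (|f x| / |x| ^ α)) absInfty < ⊤})

/-- `C_{ε, u, α} = sup_{x ∈ ℝ, s ∈ [0, T]} |u s x| / (1 + |x| ^ (α + ε))`, in `[0, ∞]`. -/
def constC (T ε : ℝ) (u : ℝ → ℝ → ℝ) (α : ℝ) : ℝ≥0∞ :=
  ⨆ s ∈ Icc 0 T, ⨆ x : ℝ, ENNReal.ofReal (|u s x| / (1 + |x| ^ (α + ε)))

/-- `δ_a = max (1, 2 ^ a)`. -/
def constδ (a : ℝ) : ℝ := max 1 ((2 : ℝ) ^ a)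

/-- `Ξ_a = a Γ((1 + a) / 2) / (2 √π)`. -/
def constΞ (a : ℝ) : ℝ := a * Real.Gamma ((1 + a) / 2) / (2 * √Real.pi)

/-- `μ(a) = ∫ φ(z) / (1 + |z| ^ a) dz`, with `φ` the standard normal density. -/
def constμ (a : ℝ) : ℝ :=
  ∫ z : ℝ, (1 / √(2 * Real.pi) * Real.exp (-z ^ 2 / 2)) / (1 + |z| ^ a)

/-- `D_a = max (1 + δ_a Ξ_a + (δ_a² / 2) (Ξ_a + (1 + a)⁻¹)², 1 / 2 + δ_a / (1 + a))`. -/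
def constD (a : ℝ) : ℝ :=
  max (1 + constδ a * constΞ a + constδ a ^ 2 / 2 * (constΞ a + (1 + a)⁻¹) ^ 2)
    (1 / 2 + constδ a / (1 + a))

/-- `M'(ε, ε') = C_{ε, v', a}² D_{a + ε} (1 + C_{ε', v⁻¹, b} ^ (2 (a + ε))) δ_{2 (a + ε)}`, where
`a` and `b` are the upper growth rates of `v'(t, ·)` and `v⁻¹(t, ·)`; its value is in `[0, ∞]`. -/
def constM' (T t : ℝ) (v : ℝ → ℝ → ℝ) (ε ε' : ℝ) : ℝ≥0∞ :=
  let a := (upperRate (spaceDeriv v t)).toReal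
  let b := (upperRate (spaceInv v t)).toReal
  constC T ε (spaceDeriv v) a ^ 2 * ENNReal.ofReal (constD (a + ε)) *
    (1 + constC T ε' (spaceInv v) b ^ (2 * (a + ε))) * ENNReal.ofReal (constδ (2 * (a + ε)))

/-- `M(ε') = μ(α̃) / (K² (1 + C_{ε', v⁻¹, b} ^ (2 α̃) δ_{2 α̃}))`, where `b` is the upper growth rate
of `v⁻¹(t, ·)`; its value is in `[0, ∞)`, and it is `0` exactly if the supremum `C` is infinite. -/
def constM (T t : ℝ) (v : ℝ → ℝ → ℝ) (K αt ε' : ℝ) : ℝ≥0∞ :=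
  let b := (upperRate (spaceInv v t)).toReal
  ENNReal.ofReal (constμ αt) /
    (ENNReal.ofReal (K ^ 2) *
      (1 + constC T ε' (spaceInv v) b ^ (2 * αt) * ENNReal.ofReal (constδ (2 * αt))))

end DensityTails

end

/-!
At the fixed time `t` the law of `P_t = v(t, W_t)` is the image of a centred Gaussian law of variance
`t` under the increasing `C¹` diffeomorphism `f = v(t, ·)`. With `g = f⁻¹` and `φ_t` the Gaussian
density, the change of variables formula gives the continuous density `ρ(y) = φ_t(g y) / f'(g y)`
(`IsIncreasingDiffeo.map_gaussianReal`), and both tail bounds are read off from this expression.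
Write `a` and `b` for the upper growth rates of `f'` and `g`; `b` is finite because the lower growth
rate of `f` is positive.

*Upper bound.* Since `f'` grows more slowly than `|x| ^ e` for every `e > a`, the function `f` grows
at most like `|x| ^ (1 + e)`. If `(1 - γ) (1 + a) < 1`, then `|f x - m| ^ (2 (1 - γ))` is thus
negligible against `x²`, while `1 / f'` is bounded by a power. With `x = g y`, the Gaussian factor
`exp (-x² / 2t)` then beats `B exp (-c |y - m| ^ (2 (1 - γ)))` for all constants `B > 0` and `c`
(`IsIncreasingDiffeo.eventually_imageDensity_le`).

*Lower bound.* From `g' = 1 / f' ∘ g` and the bound on `1 / f'`, integration shows that `g` grows at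
most like `|y| ^ (q + 1)` for some `q < p`: the exponent `b + ε' / 2` is available for `g` on the
right-hand side, whereas `p = α̃ (b + ε')`. Hence the exponent `g(y)² / 2t` of the density is
negligible against `|y - m| ^ (2 (p + 1))`
(`IsIncreasingDiffeo.eventually_le_imageDensity`). The remaining terms depend on `y₀` only, and they
have the right sign for large `y₀` because `p + 1 > 1`
(`IsIncreasingDiffeo.eventually_abs_sub_rpow_le`).

Both comparisons have room in the exponents, so they hold beyond some `y₀` whatever the values of
`M ∈ (0, ∞)` and `M' ∈ (0, ∞]`. If `M = 0`, then `M' = ∞`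
(`constM'_eq_top_of_constM_eq_zero`), and the bounds read `ρ ≤ ∞` and `ρ ≥ 0`. In this way
`exists_threshold` yields a `y₀` for all `ε, ε' > 0` and all `γ < 1` with `(1 - γ) (1 + a) < 1`.
-/

namespace DensityTails

/-! ### Growth rates and polynomial bounds -/

lemma absInfty_eq_cocompact : absInfty = cocompact ℝ := by
  rw [← Metric.cobounded_eq_cocompact, ← comap_norm_atTop]
  rfl

instance : absInfty.NeBot := by
  rw [absInfty_eq_cocompact]
  infer_instance

lemma tendsto_abs_absInfty : Tendsto (fun x : ℝ ↦ |x|) absInfty atTop := tendsto_comap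

/-- `h` grows at most like `|x| ^ β`, as a bound on the whole line. -/
def GrowthLE (h : ℝ → ℝ) (β : ℝ) : Prop :=
  ∃ C : ℝ, 0 < C ∧ ∀ x, |h x| ≤ C * (1 + |x| ^ β)

/-- On the complement of a compact set the bound is assumed, on the compact set continuity
gives it. -/
lemma GrowthLE.of_eventually {h : ℝ → ℝ} (hc : Continuous h) {C β : ℝ}
    (H : ∀ᶠ x in absInfty, |h x| ≤ C * |x| ^ β) : GrowthLE h β := by
  rw [absInfty_eq_cocompact, Filter.eventually_iff, mem_cocompact] at H
  obtain ⟨s, hs, hsub⟩ := H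
  obtain ⟨B, hB⟩ := hs.exists_bound_of_continuousOn hc.continuousOn
  refine ⟨|B| + |C| + 1, by positivity, fun x ↦ ?_⟩
  have h0 : 0 ≤ |x| ^ β := by positivity
  have h1 := le_abs_self B
  have h2 := mul_le_mul_of_nonneg_right (le_abs_self C) h0
  have h3 : 0 ≤ |B| * |x| ^ β := by positivity
  have h4 := abs_nonneg C
  have h5 := abs_nonneg B
  by_cases hx : x ∈ s
  · have := hB x hx
    rw [Real.norm_eq_abs] at this
    nlinarith
  · have : |h x| ≤ C * |x| ^ β := hsub hx
    nlinarith

lemma growthLE_of_upperRate_lt {h : ℝ → ℝ} (hc : Continuous h) (hfin : upperRate h < ⊤) {β : ℝ}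
    (hβ : (upperRate h).toReal < β) : GrowthLE h β := by
  have hlt : upperRate h < ENNReal.ofReal β := (ENNReal.lt_ofReal_iff_toReal_lt hfin.ne).2 hβ
  obtain ⟨_, ⟨α, ⟨hα, hlim⟩, rfl⟩, hαβ⟩ := sInf_lt_iff.1 hlt
  have hαβ' : α < β := (ENNReal.ofReal_lt_ofReal_iff_of_nonneg hα.le).1 hαβ
  obtain ⟨L, hL, hLtop⟩ := exists_between hlim
  refine GrowthLE.of_eventually hc (C := L.toReal) ?_
  filter_upwards [eventually_lt_of_limsup_lt hL,
    tendsto_abs_absInfty.eventually_ge_atTop 1] with x hx h1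
  have hp : 0 < |x| ^ α := by positivity
  have h2 : |h x| / |x| ^ α ≤ L.toReal :=
    (ENNReal.ofReal_le_iff_le_toReal hLtop.ne).1 hx.le
  rw [div_le_iff₀ hp] at h2
  exact h2.trans (mul_le_mul_of_nonneg_left (Real.rpow_le_rpow_of_exponent_le h1 hαβ'.le)
    ENNReal.toReal_nonneg)

lemma eventually_rpow_le_of_lowerRate_pos {f : ℝ → ℝ} (h : 0 < lowerRate f) :
    ∃ α : ℝ, 0 < α ∧ ∀ᶠ x in absInfty, |x| ^ α ≤ |f x| := by
  obtain ⟨L, hL0, hL⟩ := exists_between h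
  have hLtop : L ≠ ⊤ := (hL.trans_le le_top).ne
  refine ⟨L.toReal, ENNReal.toReal_pos hL0.ne' hLtop, ?_⟩
  have hlim : 1 < liminf (fun x ↦ ENNReal.ofReal (|f x| / |x| ^ L.toReal)) absInfty := by
    by_contra hcon
    refine absurd hL (not_lt.2 (sInf_le ⟨L.toReal, ⟨ENNReal.toReal_pos hL0.ne' hLtop, ?_⟩,
      ENNReal.ofReal_toReal hLtop⟩))
    exact (not_lt.1 hcon).trans_lt ENNReal.one_lt_top
  filter_upwards [eventually_lt_of_lt_liminf hlim,
    tendsto_abs_absInfty.eventually_ge_atTop 1] with x hx h1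
  have hp : 0 < |x| ^ L.toReal := by positivity
  have h2 : 1 < |f x| / |x| ^ L.toReal := by
    rwa [← ENNReal.ofReal_one, ENNReal.ofReal_lt_ofReal_iff_of_nonneg zero_le_one] at hx
  rw [lt_div_iff₀ hp, one_mul] at h2
  exact h2.le

lemma upperRate_lt_top_of_eventually_le {h : ℝ → ℝ} {β : ℝ} (hβ : 0 < β)
    (H : ∀ᶠ x in absInfty, |h x| ≤ |x| ^ β) : upperRate h < ⊤ := by
  refine lt_of_le_of_lt (sInf_le (Set.mem_image_of_mem _ ⟨hβ, ?_⟩)) ENNReal.ofReal_lt_top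
  refine (limsup_le_of_le (a := 1) (by isBoundedDefault) ?_).trans_lt ENNReal.one_lt_top
  filter_upwards [H] with x hx
  rw [← ENNReal.ofReal_one]
  exact ENNReal.ofReal_le_ofReal (div_le_one_of_le₀ hx (by positivity))

lemma one_add_rpow_le {r a : ℝ} (hr : 0 ≤ r) (ha : 0 ≤ a) :
    (1 + r) ^ a ≤ 2 ^ a * (1 + r ^ a) := by
  have h0 : 0 ≤ r ^ a := by positivity
  have h2 : (0 : ℝ) ≤ 2 ^ a := by positivity
  rcases le_total r 1 with h | h
  · calc (1 + r) ^ a ≤ 2 ^ a := Real.rpow_le_rpow (by linarith) (by linarith) ha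
      _ ≤ _ := by nlinarith
  · calc (1 + r) ^ a ≤ (2 * r) ^ a := Real.rpow_le_rpow (by linarith) (by linarith) ha
      _ = 2 ^ a * r ^ a := Real.mul_rpow (by norm_num) hr
      _ ≤ _ := by nlinarith

lemma GrowthLE.comp {h k : ℝ → ℝ} {a b : ℝ} (hh : GrowthLE h a) (hk : GrowthLE k b)
    (ha : 0 ≤ a) : GrowthLE (fun x ↦ h (k x)) (b * a) := by
  obtain ⟨C, hC, hC'⟩ := hh
  obtain ⟨D, hD, hD'⟩ := hk
  refine ⟨C * (1 + D ^ a * 2 ^ a), by positivity, fun x ↦ (hC' _).trans ?_⟩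
  have hr : 0 ≤ |x| ^ b := by positivity
  have h1 : |k x| ^ a ≤ D ^ a * (2 ^ a * (1 + |x| ^ (b * a))) := by
    calc |k x| ^ a ≤ (D * (1 + |x| ^ b)) ^ a := Real.rpow_le_rpow (abs_nonneg _) (hD' x) ha
      _ = D ^ a * (1 + |x| ^ b) ^ a := Real.mul_rpow hD.le (by positivity)
      _ ≤ _ := by
        rw [Real.rpow_mul (abs_nonneg x)]
        exact mul_le_mul_of_nonneg_left (one_add_rpow_le hr ha) (by positivity)
  have h2 : 0 ≤ |x| ^ (b * a) := by positivity
  rw [mul_assoc]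
  refine mul_le_mul_of_nonneg_left ?_ hC.le
  nlinarith

/-- Integrating a bound on the derivative raises the exponent by one. -/
lemma GrowthLE.of_hasDerivAt {h h' : ℝ → ℝ} {β : ℝ} (hβ : 0 ≤ β)
    (hd : ∀ x, HasDerivAt h (h' x) x) (hh : GrowthLE h' β) : GrowthLE h (β + 1) := by
  obtain ⟨C, hC, hC'⟩ := hh
  refine ⟨|h 0| + 2 * C, by positivity, fun x ↦ ?_⟩
  have key : |h x - h 0| ≤ C * (1 + |x| ^ β) * |x| := by
    have := (convex_uIcc (0 : ℝ) x).norm_image_sub_le_of_norm_hasDerivWithin_le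
      (f := h) (f' := h') (C := C * (1 + |x| ^ β)) (fun u _ ↦ (hd u).hasDerivWithinAt)
      (fun u hu ↦ ?_) left_mem_uIcc right_mem_uIcc
    · simpa [Real.norm_eq_abs] using this
    · refine (hC' u).trans (mul_le_mul_of_nonneg_left ?_ hC.le)
      have : |u| ≤ |x| := by simpa using abs_sub_left_of_mem_uIcc hu
      gcongr
  have h0 : 0 ≤ |x| ^ (β + 1) := by positivity
  have h1 : |x| ^ β * |x| = |x| ^ (β + 1) := by
    rcases eq_or_ne x 0 with rfl | hx
    · simp [Real.zero_rpow (by linarith : β + 1 ≠ 0)]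
    · rw [Real.rpow_add_one (abs_ne_zero.2 hx)]
  have h2 : |x| ≤ 1 + |x| ^ (β + 1) := by
    rcases le_total |x| 1 with h | h
    · linarith
    · have := Real.rpow_le_rpow_of_exponent_le h (by linarith : (1 : ℝ) ≤ β + 1)
      rw [Real.rpow_one] at this
      linarith
  have h3 : |h x| ≤ |h 0| + |h x - h 0| := by
    have := abs_add_le (h 0) (h x - h 0)
    rwa [add_sub_cancel] at this
  have h4 := mul_nonneg (abs_nonneg (h 0)) h0
  nlinarith

/-! ### Comparison of exponentials of powers -/

/-- A power times `exp (C r ^ s)` is eventually dominated by `exp (c r ^ s')` if `s < s'`. -/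
lemma eventually_rpow_mul_exp_le (A k C : ℝ) {s s' c : ℝ} (hs' : 0 < s') (hss : s < s')
    (hc : 0 < c) :
    ∀ᶠ r : ℝ in atTop, A * r ^ k * Real.exp (C * r ^ s) ≤ Real.exp (c * r ^ s') := by
  have h1 : ∀ᶠ r : ℝ in atTop, C * r ^ s ≤ c / 2 * r ^ s' := by
    have ht := (tendsto_rpow_neg_atTop (sub_pos.2 hss)).const_mul C
    rw [mul_zero] at ht
    filter_upwards [ht.eventually_le_const (half_pos hc), eventually_gt_atTop 0] with r hr h0
    have : r ^ s = r ^ (-(s' - s)) * r ^ s' := by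
      rw [← Real.rpow_add h0]
      ring_nf
    rw [this, ← mul_assoc]
    exact mul_le_mul_of_nonneg_right hr (by positivity)
  have h2 : ∀ᶠ r : ℝ in atTop, A * r ^ k ≤ Real.exp (c / 2 * r ^ s') := by
    have hb := (isLittleO_rpow_exp_pos_mul_atTop (k / s') (half_pos hc)).comp_tendsto
      (tendsto_rpow_atTop hs')
    filter_upwards [(hb.const_mul_left A).bound one_pos, eventually_gt_atTop 0] with r hr h0
    simp only [Function.comp_apply, Real.norm_eq_abs, Real.abs_exp, one_mul] at hr
    rw [← Real.rpow_mul h0.le, mul_div_cancel₀ _ hs'.ne'] at hr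
    exact (le_abs_self _).trans hr
  filter_upwards [h1, h2] with r hr1 hr2
  calc A * r ^ k * Real.exp (C * r ^ s)
      ≤ Real.exp (c / 2 * r ^ s') * Real.exp (c / 2 * r ^ s') := by gcongr
    _ = Real.exp (c * r ^ s') := by
      rw [← Real.exp_add]
      ring_nf

/-! ### Increasing bijections of the line -/

/-- `f` is a `C¹` function with positive derivative that is unbounded in both directions, hence a
`C¹` diffeomorphism of the line. -/
structure IsIncreasingDiffeo (f : ℝ → ℝ) : Prop where
  diff : Differentiable ℝ f
  cont_deriv : Continuous (deriv f)
  pos : ∀ x, 0 < deriv f x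
  not_bddAbove : ¬ BddAbove (range f)
  not_bddBelow : ¬ BddBelow (range f)

namespace IsIncreasingDiffeo

variable {f : ℝ → ℝ} (hf : IsIncreasingDiffeo f)
include hf

lemma strictMono : StrictMono f := strictMono_of_deriv_pos hf.pos

lemma surjective : Function.Surjective f := by
  intro y
  obtain ⟨_, ⟨a, rfl⟩, ha⟩ := not_bddBelow_iff.1 hf.not_bddBelow y
  obtain ⟨_, ⟨b, rfl⟩, hb⟩ := not_bddAbove_iff.1 hf.not_bddAbove y
  exact mem_range_of_exists_le_of_exists_ge hf.diff.continuous ⟨a, ha.le⟩ ⟨b, hb.le⟩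

lemma apply_invFun (y : ℝ) : f (Function.invFun f y) = y :=
  Function.rightInverse_invFun hf.surjective y

lemma invFun_apply (x : ℝ) : Function.invFun f (f x) = x :=
  Function.leftInverse_invFun hf.strictMono.injective x

lemma strictMono_invFun : StrictMono (Function.invFun f) := fun a b hab ↦ by
  rwa [← hf.strictMono.lt_iff_lt, hf.apply_invFun, hf.apply_invFun]

lemma continuous_invFun : Continuous (Function.invFun f) :=
  hf.strictMono_invFun.monotone.continuous_of_surjective fun x ↦ ⟨f x, hf.invFun_apply x⟩

lemma hasDerivAt_invFun (y : ℝ) :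
    HasDerivAt (Function.invFun f) (deriv f (Function.invFun f y))⁻¹ y :=
  HasDerivAt.of_local_left_inverse hf.continuous_invFun.continuousAt (hf.diff _).hasDerivAt
    (hf.pos _).ne' (Eventually.of_forall hf.apply_invFun)

lemma tendsto_invFun : Tendsto (Function.invFun f) absInfty absInfty := by
  rw [absInfty_eq_cocompact]
  let e : ℝ ≃ₜ ℝ :=
    { toFun := Function.invFun f
      invFun := f
      left_inv := hf.apply_invFun
      right_inv := hf.invFun_apply
      continuous_toFun := hf.continuous_invFun
      continuous_invFun := hf.diff.continuous }
  exact e.isClosedEmbedding.tendsto_cocompact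

/-- A positive lower growth rate of `f` makes the upper growth rate of its inverse finite. -/
lemma upperRate_invFun_lt_top (h : 0 < lowerRate f) : upperRate (Function.invFun f) < ⊤ := by
  obtain ⟨α, hα, H⟩ := eventually_rpow_le_of_lowerRate_pos h
  refine upperRate_lt_top_of_eventually_le (β := α⁻¹) (inv_pos.2 hα) ?_
  filter_upwards [hf.tendsto_invFun.eventually H] with y hy
  rw [hf.apply_invFun] at hy
  exact (Real.le_rpow_inv_iff_of_pos (abs_nonneg _) (abs_nonneg _) hα).2 hy

end IsIncreasingDiffeo

/-! ### The density of the image of a Gaussian variable -/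

/-- The density `φ_t (f⁻¹ y) / f' (f⁻¹ y)` of the law of `f X`, for `X` centred Gaussian of
variance `t` and `f` an increasing diffeomorphism. -/
noncomputable def imageDensity (t : ℝ≥0) (f : ℝ → ℝ) (y : ℝ) : ℝ≥0 :=
  (gaussianPDFReal 0 t (Function.invFun f y) / deriv f (Function.invFun f y)).toNNReal

namespace IsIncreasingDiffeo

variable {f : ℝ → ℝ} (hf : IsIncreasingDiffeo f)
include hf

lemma coe_imageDensity (t : ℝ≥0) (y : ℝ) : (imageDensity t f y : ℝ) =
    gaussianPDFReal 0 t (Function.invFun f y) / deriv f (Function.invFun f y) :=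
  Real.coe_toNNReal _ (div_nonneg (gaussianPDFReal_nonneg _ _ _) (hf.pos _).le)

lemma continuous_imageDensity (t : ℝ≥0) : Continuous (imageDensity t f) := by
  have h1 : Continuous (gaussianPDFReal 0 t) := by
    unfold gaussianPDFReal
    fun_prop
  exact continuous_real_toNNReal.comp ((h1.comp hf.continuous_invFun).div
    (hf.cont_deriv.comp hf.continuous_invFun) fun y ↦ (hf.pos _).ne')

lemma map_gaussianReal {t : ℝ≥0} (ht : t ≠ 0) : (gaussianReal 0 t).map f =
    volume.withDensity (fun y ↦ (imageDensity t f y : ℝ≥0∞)) := by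
  ext s hs
  rw [Measure.map_apply hf.diff.continuous.measurable hs, withDensity_apply _ hs,
    gaussianReal_apply _ ht]
  have himg : f ⁻¹' s = Function.invFun f '' s := by
    ext x
    exact ⟨fun hx ↦ ⟨f x, hx, hf.invFun_apply x⟩, by
      rintro ⟨y, hy, rfl⟩
      rwa [mem_preimage, hf.apply_invFun]⟩
  rw [himg, lintegral_image_eq_lintegral_abs_deriv_mul hs
    (fun y _ ↦ (hf.hasDerivAt_invFun y).hasDerivWithinAt)
    hf.strictMono_invFun.injective.injOn]
  refine lintegral_congr fun y ↦ ?_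
  rw [abs_of_pos (inv_pos.2 (hf.pos _)), gaussianPDF,
    ← ENNReal.ofReal_mul (inv_pos.2 (hf.pos _)).le, mul_comm, ← div_eq_mul_inv]
  rfl

/-! ### Tails of the density -/

/-- Substituting `y = f x`, the bound compares `exp (-x² / 2t)` with
`exp (-c |f x| ^ s)`, and `|f x| ^ s` grows more slowly than `x²`. -/
lemma eventually_imageDensity_le {t : ℝ≥0} (ht : t ≠ 0) {a b s B c : ℝ} (m : ℝ)
    (hinv : GrowthLE (fun x ↦ 1 / deriv f x) a) (hfb : GrowthLE f b) (ha : 0 ≤ a) (hb : 0 ≤ b)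
    (hs : 0 ≤ s) (hbs : b * s < 2) (hB : 0 < B) (hc : 0 ≤ c) :
    ∀ᶠ y in absInfty, (imageDensity t f y : ℝ) ≤ B * Real.exp (-(c * |y - m| ^ s)) := by
  have ht' : (0 : ℝ) < t := by positivity
  obtain ⟨C, hC, hC'⟩ := hinv
  obtain ⟨D, hD, hD'⟩ := hfb
  have hE := eventually_rpow_mul_exp_le ((√(2 * Real.pi * t))⁻¹ * (2 * C) / B) a
    (c * (2 * D + |m|) ^ s) (s' := 2) (c := 1 / (2 * t)) two_pos hbs (by positivity)
  filter_upwards [hf.tendsto_invFun.eventually (tendsto_abs_absInfty.eventually hE),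
    hf.tendsto_invFun.eventually (tendsto_abs_absInfty.eventually_ge_atTop 1)] with y hy h1
  rw [hf.coe_imageDensity]
  set x := Function.invFun f y with hx
  have hyx : y = f x := (hf.apply_invFun y).symm
  have hder : 1 / deriv f x ≤ 2 * C * |x| ^ a := by
    have := (le_abs_self _).trans (hC' x)
    have h2 := Real.one_le_rpow h1 ha
    nlinarith
  have hval : |y - m| ^ s ≤ (2 * D + |m|) ^ s * |x| ^ (b * s) := by
    rw [Real.rpow_mul (abs_nonneg x), ← Real.mul_rpow (by positivity) (by positivity)]
    refine Real.rpow_le_rpow (abs_nonneg _) ?_ hs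
    have h2 := Real.one_le_rpow h1 hb
    have h3 := abs_sub y m
    have h4 := hD' x
    have h5 := mul_nonneg (abs_nonneg m) (sub_nonneg.2 h2)
    rw [← hyx] at h4
    nlinarith
  have hexp : Real.exp (c * |y - m| ^ s) ≤
      Real.exp (c * (2 * D + |m|) ^ s * |x| ^ (b * s)) := by
    rw [Real.exp_le_exp, mul_assoc]
    exact mul_le_mul_of_nonneg_left hval hc
  rw [gaussianPDFReal, Real.exp_neg, ← div_eq_mul_inv, le_div_iff₀ (Real.exp_pos _)]
  have hsq : -(x - 0) ^ 2 / (2 * t) = -(1 / (2 * t) * |x| ^ (2 : ℝ)) := by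
    rw [Real.rpow_two, sq_abs]
    ring
  rw [hsq, Real.exp_neg]
  calc (√(2 * Real.pi * t))⁻¹ * (Real.exp (1 / (2 * t) * |x| ^ (2 : ℝ)))⁻¹ / deriv f x *
        Real.exp (c * |y - m| ^ s)
      = (√(2 * Real.pi * t))⁻¹ * (1 / deriv f x) * Real.exp (c * |y - m| ^ s) *
        (Real.exp (1 / (2 * t) * |x| ^ (2 : ℝ)))⁻¹ := by ring
    _ ≤ (√(2 * Real.pi * t))⁻¹ * (2 * C * |x| ^ a) *
        Real.exp (c * (2 * D + |m|) ^ s * |x| ^ (b * s)) *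
        (Real.exp (1 / (2 * t) * |x| ^ (2 : ℝ)))⁻¹ := by gcongr
    _ = B * ((√(2 * Real.pi * t))⁻¹ * (2 * C) / B * |x| ^ a *
        Real.exp (c * (2 * D + |m|) ^ s * |x| ^ (b * s))) *
        (Real.exp (1 / (2 * t) * |x| ^ (2 : ℝ)))⁻¹ := by field_simp
    _ ≤ B * Real.exp (1 / (2 * t) * |x| ^ (2 : ℝ)) *
        (Real.exp (1 / (2 * t) * |x| ^ (2 : ℝ)))⁻¹ := by gcongr
    _ = B := by field_simp

/-- The exponent `(f⁻¹ y)² / 2t` of the density is of order `|y| ^ (2 b)` at most, and so is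
dominated by `c |y - m| ^ s`. -/
lemma eventually_le_imageDensity {t : ℝ≥0} (ht : t ≠ 0) {a b s B c : ℝ} (m : ℝ)
    (hder : GrowthLE (deriv f) a) (hg : GrowthLE (Function.invFun f) b) (ha : 0 ≤ a) (hb : 0 ≤ b)
    (hbs : 2 * b < s) (hB : 0 ≤ B) (hc : 0 < c) :
    ∀ᶠ y in absInfty, B * Real.exp (-(c * |y - m| ^ s)) ≤ (imageDensity t f y : ℝ) := by
  have ht' : (0 : ℝ) < t := by positivity
  obtain ⟨C, hC, hC'⟩ := hder.comp hg ha
  obtain ⟨D, hD, hD'⟩ := hg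
  have hs : 0 < s := by linarith
  have hE := eventually_rpow_mul_exp_le (B * (2 * C) * √(2 * Real.pi * t)) (b * a)
    ((2 * D) ^ 2 / (2 * t)) (s' := s) (c := c * 2⁻¹ ^ s) hs hbs (by positivity)
  filter_upwards [tendsto_abs_absInfty.eventually hE,
    tendsto_abs_absInfty.eventually_ge_atTop 1,
    tendsto_abs_absInfty.eventually_ge_atTop (2 * |m|)] with y hy h1 hm
  rw [hf.coe_imageDensity]
  have hgy : |Function.invFun f y| ≤ 2 * D * |y| ^ b := by
    have h2 := Real.one_le_rpow h1 hb
    have := hD' y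
    nlinarith
  have hdy : deriv f (Function.invFun f y) ≤ 2 * C * |y| ^ (b * a) := by
    have h2 := Real.one_le_rpow h1 (mul_nonneg hb ha)
    have := (le_abs_self _).trans (hC' y)
    nlinarith
  have hfar : c * 2⁻¹ ^ s * |y| ^ s ≤ c * |y - m| ^ s := by
    rw [mul_assoc, ← Real.mul_rpow (by norm_num) (abs_nonneg y)]
    refine mul_le_mul_of_nonneg_left (Real.rpow_le_rpow (by positivity) ?_ hs.le) hc.le
    have := abs_sub_abs_le_abs_sub y m
    linarith
  have hsq : Function.invFun f y ^ 2 ≤ (2 * D) ^ 2 * |y| ^ (2 * b) := by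
    rw [mul_comm 2 b, Real.rpow_mul (abs_nonneg y), Real.rpow_two, ← mul_pow,
      ← sq_abs (Function.invFun f y)]
    gcongr
  have hgauss : Real.exp (-((2 * D) ^ 2 / (2 * t) * |y| ^ (2 * b))) ≤
      Real.exp (-(Function.invFun f y - 0) ^ 2 / (2 * t)) := by
    rw [Real.exp_le_exp, sub_zero, neg_div, neg_le_neg_iff, div_mul_eq_mul_div]
    gcongr
  have hd0 := hf.pos (Function.invFun f y)
  have hsqrt : 0 < √(2 * Real.pi * t) := by positivity
  rw [gaussianPDFReal, le_div_iff₀ hd0]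
  calc B * Real.exp (-(c * |y - m| ^ s)) * deriv f (Function.invFun f y)
      ≤ B * Real.exp (-(c * 2⁻¹ ^ s * |y| ^ s)) * (2 * C * |y| ^ (b * a)) := by gcongr
    _ = (√(2 * Real.pi * t))⁻¹ * ((B * (2 * C) * √(2 * Real.pi * t) * |y| ^ (b * a) *
          Real.exp ((2 * D) ^ 2 / (2 * t) * |y| ^ (2 * b))) *
          Real.exp (-((2 * D) ^ 2 / (2 * t) * |y| ^ (2 * b)))) *
          Real.exp (-(c * 2⁻¹ ^ s * |y| ^ s)) := by
        rw [mul_assoc (_ * _) (Real.exp _) (Real.exp _), ← Real.exp_add, add_neg_cancel,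
          Real.exp_zero]
        field_simp
    _ ≤ (√(2 * Real.pi * t))⁻¹ * (Real.exp (c * 2⁻¹ ^ s * |y| ^ s) *
          Real.exp (-((2 * D) ^ 2 / (2 * t) * |y| ^ (2 * b)))) *
          Real.exp (-(c * 2⁻¹ ^ s * |y| ^ s)) := by gcongr
    _ = (√(2 * Real.pi * t))⁻¹ * Real.exp (-((2 * D) ^ 2 / (2 * t) * |y| ^ (2 * b))) *
          (Real.exp (c * 2⁻¹ ^ s * |y| ^ s) * Real.exp (-(c * 2⁻¹ ^ s * |y| ^ s))) := by ring
    _ = (√(2 * Real.pi * t))⁻¹ * Real.exp (-((2 * D) ^ 2 / (2 * t) * |y| ^ (2 * b))) := by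
        rw [← Real.exp_add, add_neg_cancel, Real.exp_zero, mul_one]
    _ ≤ _ := by gcongr

/-- The upper bound, for any constants `M < ∞` and `M'`. If `M = 0` the right-hand side is `∞`. -/
lemma eventually_upper_bound {t : ℝ≥0} (ht : t ≠ 0) {a b p γ A : ℝ} (m : ℝ) {M M' : ℝ≥0∞}
    (hinv : GrowthLE (fun x ↦ 1 / deriv f x) a) (hfb : GrowthLE f b) (ha : 0 ≤ a) (hb : 0 ≤ b)
    (hγ : γ < 1) (hbγ : b * (2 * (1 - γ)) < 2) (hA : 0 < A) (hM : M ≠ ⊤) :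
    ∀ᶠ y in absInfty, ∀ y₀ : ℝ, (imageDensity t f y : ℝ≥0∞) ≤
      ENNReal.ofReal A / (2 * M * t) * ENNReal.ofReal (1 + |y| ^ (2 * p)) *
        ENNReal.ofReal (Real.exp
          (-((|y - m| ^ (2 * (1 - γ)) - |y₀ - m| ^ (2 * (1 - γ))) / (4 * (1 - γ) * t) *
            M'⁻¹.toReal))) := by
  have ht' : (0 : ℝ) < t := by positivity
  have hγ' : 0 < 1 - γ := sub_pos.2 hγ
  rcases eq_or_ne M 0 with rfl | hM0
  · refine Eventually.of_forall fun y y₀ ↦ ?_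
    have h1 : ENNReal.ofReal (1 + |y| ^ (2 * p)) ≠ 0 := by
      rw [Ne, ENNReal.ofReal_eq_zero, not_le]
      positivity
    have h2 : ∀ x, ENNReal.ofReal (Real.exp x) ≠ 0 := fun x ↦ by
      rw [Ne, ENNReal.ofReal_eq_zero, not_le]
      positivity
    rw [mul_zero, zero_mul, ENNReal.div_zero (by simpa using hA), ENNReal.top_mul h1,
      ENNReal.top_mul (h2 _)]
    exact le_top
  have hMpos : 0 < M.toReal := ENNReal.toReal_pos hM0 hM
  have hpre : ENNReal.ofReal (A / (2 * M.toReal * t)) = ENNReal.ofReal A / (2 * M * t) := by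
    rw [ENNReal.ofReal_div_of_pos (by positivity), ENNReal.ofReal_mul (by positivity),
      ENNReal.ofReal_mul (by positivity), ENNReal.ofReal_toReal hM, ENNReal.ofReal_coe_nnreal,
      ENNReal.ofReal_ofNat]
  have hM'0 : 0 ≤ M'⁻¹.toReal := ENNReal.toReal_nonneg
  have hB : 0 < A / (2 * M.toReal * t) := by positivity
  filter_upwards [hf.eventually_imageDensity_le ht m hinv hfb ha hb
    (by positivity : 0 ≤ 2 * (1 - γ)) hbγ hB
    (by positivity : 0 ≤ M'⁻¹.toReal / (4 * (1 - γ) * t))] with y hy y₀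
  rw [← hpre, ← ENNReal.ofReal_mul hB.le, ← ENNReal.ofReal_mul (by positivity),
    ← ENNReal.ofReal_coe_nnreal]
  refine ENNReal.ofReal_le_ofReal (hy.trans ?_)
  have h1 : 0 ≤ |y| ^ (2 * p) := by positivity
  refine mul_le_mul (le_mul_of_one_le_right hB.le (by linarith)) (Real.exp_le_exp.2 ?_)
    (Real.exp_pos _).le (by positivity)
  have h2 : 0 ≤ |y₀ - m| ^ (2 * (1 - γ)) / (4 * (1 - γ) * t) * M'⁻¹.toReal := by positivity
  rw [sub_div, sub_mul, neg_le_neg_iff, div_mul_eq_mul_div M'⁻¹.toReal, mul_comm M'⁻¹.toReal,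
    ← div_mul_eq_mul_div]
  linarith

omit hf in
/-- The factor at `y₀` in the lower bound outweighs the term `|y₀ - m| ^ (2 (p + 1))` that is
subtracted in the exponent, because `p + 1 > 1` and `|y₀ - m| / |y₀| → 1`. -/
lemma eventually_abs_sub_rpow_le (m : ℝ) {p : ℝ} (hp : 0 < p) :
    ∀ᶠ y₀ : ℝ in atTop,
      |y₀ - m| ^ (2 * (p + 1)) / (p + 1) ≤ |y₀ - m| ^ 2 * (1 + y₀ ^ (2 * p)) := by
  have h1 : Tendsto (fun y : ℝ ↦ |1 - m / y| ^ (2 * p)) atTop (𝓝 (|1 - 0| ^ (2 * p))) :=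
    ((tendsto_const_nhds.sub (tendsto_const_nhds.div_atTop tendsto_id)).abs).rpow_const
      (Or.inr (by positivity))
  rw [sub_zero, abs_one, Real.one_rpow] at h1
  filter_upwards [h1.eventually_le_const (by linarith : 1 < p + 1), eventually_gt_atTop 0,
    eventually_gt_atTop m] with y hy hy0 hym
  have hpos : 0 < |y - m| := abs_pos.2 (sub_pos.2 hym).ne'
  have h2 : |y - m| ^ (2 * p) ≤ (p + 1) * y ^ (2 * p) := by
    have : |y - m| = |1 - m / y| * y := by
      nth_rewrite 3 [← abs_of_pos hy0]
      rw [← abs_mul]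
      congr 1
      field_simp
    rw [this, Real.mul_rpow (abs_nonneg _) hy0.le]
    gcongr
  rw [div_le_iff₀ (by positivity), show 2 * (p + 1) = 2 + 2 * p by ring,
    Real.rpow_add hpos, Real.rpow_two, mul_assoc]
  gcongr
  linarith

/-- The lower bound, for any constants `M < ∞` and `M' > 0` such that `M' = ∞` if `M = 0`. If
`M' = ∞` the left-hand side vanishes. -/
lemma eventually_lower_bound {t : ℝ≥0} (ht : t ≠ 0) {a b p γ A : ℝ} (m : ℝ) {M M' : ℝ≥0∞}
    (hder : GrowthLE (deriv f) a) (hg : GrowthLE (Function.invFun f) b) (ha : 0 ≤ a) (hb : 0 ≤ b)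
    (hp : 0 < p) (hbp : b < p + 1) (hA : 0 < A) (hM : M ≠ ⊤) (hM' : M' ≠ 0)
    (hMM' : M = 0 → M' = ⊤) :
    ∀ᶠ y in absInfty, ∀ y₀ : ℝ,
      |y₀ - m| ^ (2 * (p + 1)) / (p + 1) ≤ |y₀ - m| ^ 2 * (1 + y₀ ^ (2 * p)) →
      ENNReal.ofReal A / (2 * M' * t * ENNReal.ofReal (1 + |y| ^ γ)) *
        ENNReal.ofReal (Real.exp
          (-((|y - m| ^ (2 * (p + 1)) - |y₀ - m| ^ (2 * (p + 1))) / (t * (p + 1)) *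
            M⁻¹.toReal))) *
        ENNReal.ofReal (Real.exp
          (-(|y₀ - m| ^ 2 / t * (1 + y₀ ^ (2 * p)) * M⁻¹.toReal))) ≤
      (imageDensity t f y : ℝ≥0∞) := by
  have ht' : (0 : ℝ) < t := by positivity
  have hw : ∀ y : ℝ, 0 < 1 + |y| ^ γ := fun y ↦ by positivity
  rcases eq_or_ne M' ⊤ with rfl | hM'top
  · refine Eventually.of_forall fun y y₀ _ ↦ ?_
    have h1 : ENNReal.ofReal (1 + |y| ^ γ) ≠ 0 := by
      rw [Ne, ENNReal.ofReal_eq_zero, not_le]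
      exact hw y
    have h2 : (t : ℝ≥0∞) ≠ 0 := by simpa using ht
    rw [ENNReal.mul_top two_ne_zero, ENNReal.top_mul h2, ENNReal.top_mul h1, ENNReal.div_top,
      zero_mul, zero_mul]
    exact zero_le
  have hM0 : M ≠ 0 := fun h ↦ hM'top (hMM' h)
  have hL : 0 < M⁻¹.toReal :=
    ENNReal.toReal_pos (ENNReal.inv_ne_zero.2 hM) (ENNReal.inv_ne_top.2 hM0)
  have hM'pos : 0 < M'.toReal := ENNReal.toReal_pos hM' hM'top
  filter_upwards [hf.eventually_le_imageDensity ht m hder hg ha hb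
    (by linarith : 2 * b < 2 * (p + 1)) (by positivity : 0 ≤ A / (2 * M'.toReal * t))
    (by positivity : 0 < M⁻¹.toReal / (t * (p + 1)))] with y hy y₀ hy₀
  have hpre : ENNReal.ofReal A / (2 * M' * t * ENNReal.ofReal (1 + |y| ^ γ)) =
      ENNReal.ofReal (A / (2 * M'.toReal * t * (1 + |y| ^ γ))) := by
    rw [ENNReal.ofReal_div_of_pos (mul_pos (by positivity) (hw y)),
      ENNReal.ofReal_mul (by positivity), ENNReal.ofReal_mul (by positivity),
      ENNReal.ofReal_mul (by positivity), ENNReal.ofReal_toReal hM'top,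
      ENNReal.ofReal_coe_nnreal, ENNReal.ofReal_ofNat]
  rw [hpre, ← ENNReal.ofReal_mul (by positivity), ← ENNReal.ofReal_mul (by positivity),
    ← ENNReal.ofReal_coe_nnreal, mul_assoc, ← Real.exp_add]
  refine ENNReal.ofReal_le_ofReal (le_trans ?_ hy)
  have h1 : 0 ≤ |y| ^ γ := by positivity
  refine mul_le_mul ?_ (Real.exp_le_exp.2 ?_) (Real.exp_pos _).le (by positivity)
  · exact div_le_div_of_nonneg_left hA.le (by positivity)
      (le_mul_of_one_le_right (by positivity) (by linarith))
  · have h2 := mul_le_mul_of_nonneg_right hy₀ (by positivity : 0 ≤ M⁻¹.toReal / t)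
    have e1 : (|y - m| ^ (2 * (p + 1)) - |y₀ - m| ^ (2 * (p + 1))) / (t * (p + 1)) * M⁻¹.toReal =
        M⁻¹.toReal / (t * (p + 1)) * |y - m| ^ (2 * (p + 1)) -
          |y₀ - m| ^ (2 * (p + 1)) / (p + 1) * (M⁻¹.toReal / t) := by
      field_simp
    have e2 : |y₀ - m| ^ 2 / t * (1 + y₀ ^ (2 * p)) * M⁻¹.toReal =
        |y₀ - m| ^ 2 * (1 + y₀ ^ (2 * p)) * (M⁻¹.toReal / t) := by
      field_simp
    rw [e1, e2]
    linarith

end IsIncreasingDiffeo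

/-! ### The constants -/

lemma constμ_pos {a : ℝ} (ha : 0 < a) : 0 < constμ a := by
  have hden : ∀ z : ℝ, 0 < 1 + |z| ^ a := fun z ↦ by positivity
  have hpos : ∀ z : ℝ,
      0 < (1 / √(2 * Real.pi) * Real.exp (-z ^ 2 / 2)) / (1 + |z| ^ a) := fun z ↦
    div_pos (by positivity) (hden z)
  have hcont : Continuous fun z : ℝ ↦
      (1 / √(2 * Real.pi) * Real.exp (-z ^ 2 / 2)) / (1 + |z| ^ a) :=
    Continuous.div (by fun_prop)
      (continuous_const.add (continuous_abs.rpow_const fun _ ↦ Or.inr ha.le))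
      fun z ↦ (hden z).ne'
  have hint : Integrable fun z : ℝ ↦
      (1 / √(2 * Real.pi) * Real.exp (-z ^ 2 / 2)) / (1 + |z| ^ a) := by
    refine (integrable_gaussianPDFReal 0 1).mono' hcont.aestronglyMeasurable
      (Eventually.of_forall fun z ↦ ?_)
    have h0 : 0 ≤ |z| ^ a := by positivity
    rw [Real.norm_of_nonneg (hpos z).le]
    refine (div_le_self (by positivity) (by linarith)).trans (le_of_eq ?_)
    simp [gaussianPDFReal]
  rw [constμ, integral_pos_iff_support_of_nonneg (fun z ↦ (hpos z).le) hint]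
  have : Function.support (fun z : ℝ ↦
      (1 / √(2 * Real.pi) * Real.exp (-z ^ 2 / 2)) / (1 + |z| ^ a)) = univ :=
    Set.eq_univ_of_forall fun z ↦ (hpos z).ne'
  rw [this]
  simp

lemma constδ_pos (a : ℝ) : 0 < constδ a := lt_max_of_lt_left one_pos

lemma constD_pos {a : ℝ} (ha : 0 < a) : 0 < constD a :=
  lt_max_of_lt_right (by have := constδ_pos a; positivity)

lemma constM_ne_top (T t : ℝ) (v : ℝ → ℝ → ℝ) {K : ℝ} (hK : 0 < K) (αt ε' : ℝ) :
    constM T t v K αt ε' ≠ ⊤ := by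
  refine ENNReal.div_ne_top ENNReal.ofReal_ne_top (mul_ne_zero ?_ ?_)
  · rw [Ne, ENNReal.ofReal_eq_zero, not_le]
    positivity
  · simp

section

variable {T t : ℝ} {v : ℝ → ℝ → ℝ} (ht : t ∈ Icc 0 T) (hpos : ∀ x, 0 < spaceDeriv v t x)
include ht hpos

lemma constC_spaceDeriv_ne_zero (ε a : ℝ) : constC T ε (spaceDeriv v) a ≠ 0 := by
  refine ((lt_of_lt_of_le ?_ (le_iSup₂_of_le (f := fun s (_ : s ∈ Icc 0 T) ↦
    ⨆ x : ℝ, ENNReal.ofReal (|spaceDeriv v s x| / (1 + |x| ^ (a + ε)))) t ht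
      (le_iSup _ 0))).ne' : _)
  have := hpos 0
  rw [ENNReal.ofReal_pos]
  positivity

lemma constM'_ne_zero {ε : ℝ} (hε : 0 < ε) (ε' : ℝ) : constM' T t v ε ε' ≠ 0 := by
  have ha : 0 < (upperRate (spaceDeriv v t)).toReal + ε :=
    add_pos_of_nonneg_of_pos ENNReal.toReal_nonneg hε
  refine mul_ne_zero (mul_ne_zero (mul_ne_zero (pow_ne_zero 2
    (constC_spaceDeriv_ne_zero ht hpos _ _)) ?_) (by simp)) ?_
  · simpa using constD_pos ha
  · simpa using constδ_pos _

/-- `M` vanishes only if the supremum for the inverse function is infinite, and then `M'` is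
infinite as well. -/
lemma constM'_eq_top_of_constM_eq_zero {K αt ε ε' : ℝ} (hαt : 0 < αt) (hε : 0 < ε)
    (h : constM T t v K αt ε' = 0) : constM' T t v ε ε' = ⊤ := by
  have ha : 0 < (upperRate (spaceDeriv v t)).toReal + ε :=
    add_pos_of_nonneg_of_pos ENNReal.toReal_nonneg hε
  have hC : constC T ε' (spaceInv v) (upperRate (spaceInv v t)).toReal = ⊤ := by
    by_contra hC
    rcases ENNReal.div_eq_zero_iff.1 h with h | h
    · exact (ENNReal.ofReal_pos.2 (constμ_pos hαt)).ne' h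
    · refine ENNReal.mul_ne_top ENNReal.ofReal_ne_top (ENNReal.add_ne_top.2
        ⟨ENNReal.one_ne_top, ENNReal.mul_ne_top (ENNReal.rpow_ne_top_of_nonneg (by positivity) hC)
          ENNReal.ofReal_ne_top⟩) h
  have h1 : constC T ε (spaceDeriv v) (upperRate (spaceDeriv v t)).toReal ^ 2 *
      ENNReal.ofReal (constD ((upperRate (spaceDeriv v t)).toReal + ε)) ≠ 0 :=
    mul_ne_zero (pow_ne_zero 2 (constC_spaceDeriv_ne_zero ht hpos _ _))
      (by simpa using constD_pos ha)
  simp only [constM']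
  rw [hC, ENNReal.top_rpow_of_pos (by positivity), add_top, ENNReal.mul_top h1,
    ENNReal.top_mul (by simpa using constδ_pos _)]

end

/-! ### The law at a fixed time -/

lemma IsBrownianUpTo.hasLaw_eval {Ω : Type*} [MeasurableSpace Ω] {P : Measure Ω} {T t : ℝ≥0}
    {W : ℝ≥0 → Ω → ℝ} (hW : IsBrownianUpTo T W P) (htT : t ≤ T) :
    HasLaw (W t) (gaussianReal 0 t) P :=
  (BrownianReal.measurePreserving_eval_projectiveFamily ⟨t, by simp⟩).hasLaw.comp
    (hW.hasLaw {t} (by simpa using htT))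

lemma IsC11.isIncreasingDiffeo {T t : ℝ} {v : ℝ → ℝ → ℝ} (hv : IsC11 T v) (ht : t ∈ Icc 0 T)
    (hpos : ∀ x, 0 < spaceDeriv v t x)
    (hunb : ¬ BddAbove (range (v t)) ∧ ¬ BddBelow (range (v t))) :
    IsIncreasingDiffeo (v t) where
  diff := hv.diff_space t ht
  cont_deriv := hv.cont_space.comp_continuous (f := fun x : ℝ ↦ (t, x)) (by fun_prop)
    fun _ ↦ ⟨ht, mem_univ _⟩
  pos := hpos
  not_bddAbove := hunb.1
  not_bddBelow := hunb.2

/-- A variable with a density is not almost surely constant. -/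
lemma integral_abs_sub_pos {Ω : Type*} [MeasurableSpace Ω] {P : Measure Ω}
    [IsProbabilityMeasure P] {Z : Ω → ℝ} (hZ : Integrable Z P) {ρ : ℝ → ℝ≥0∞}
    (hρ : P.map Z = volume.withDensity ρ) (m : ℝ) : 0 < ∫ ω, |Z ω - m| ∂P := by
  refine lt_of_le_of_ne (integral_nonneg fun _ ↦ abs_nonneg _) fun h ↦ ?_
  have h1 := (integral_eq_zero_iff_of_nonneg (fun _ ↦ abs_nonneg _)
    (hZ.sub (integrable_const m)).abs).1 h.symm
  have h2 : ∀ᵐ ω ∂P, Z ω ∈ ({m} : Set ℝ) := by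
    filter_upwards [h1] with ω hω
    exact sub_eq_zero.1 (abs_eq_zero.1 hω)
  have h3 : P.map Z {m} = 0 := by
    rw [hρ]
    exact withDensity_absolutelyContinuous _ _ (measure_singleton m)
  have h4 : P (Z ⁻¹' {m}) = 1 :=
    (measure_congr (eventuallyEq_univ.2 h2)).trans measure_univ
  rw [Measure.map_apply_of_aemeasurable hZ.aemeasurable (measurableSet_singleton m), h4] at h3
  exact one_ne_zero h3

/-- The two tail bounds hold for all `ε, ε' > 0` and for all `γ < 1` with `(1 - γ) (1 + a) < 1`,
where `a` is the upper growth rate of the derivative. -/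
theorem exists_threshold {T : ℝ} {t : ℝ≥0} {v : ℝ → ℝ → ℝ} (ht0 : 0 < t)
    (ht : (t : ℝ) ∈ Icc 0 T) (hf : IsIncreasingDiffeo (v t))
    (hup : upperRate (spaceDeriv v t) < ⊤) (hupinv : upperRate (spaceInv v t) < ⊤)
    {K αt : ℝ} (hK : 0 < K) (hαt : 0 < αt)
    (hinv : ∀ x : ℝ, 1 / spaceDeriv v t x ≤ K * (1 + |x| ^ αt))
    {ε ε' γ A : ℝ} (hε : 0 < ε) (hε' : 0 < ε') (hγ : γ < 1)
    (hγa : (1 - γ) * (1 + (upperRate (spaceDeriv v t)).toReal) < 1) (hA : 0 < A) (m : ℝ) :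
    ∃ y₀ : ℝ, 0 < y₀ ∧
      let M : ℝ≥0∞ := constM T t v K αt ε'
      let M' : ℝ≥0∞ := constM' T t v ε ε'
      let p : ℝ := αt * ((upperRate (spaceInv v t)).toReal + ε')
      ∀ y : ℝ, y₀ < |y| →
        (imageDensity t (v t) y : ℝ≥0∞) ≤
          ENNReal.ofReal A / (2 * M * t) * ENNReal.ofReal (1 + |y| ^ (2 * p)) *
            ENNReal.ofReal (Real.exp
              (-((|y - m| ^ (2 * (1 - γ)) - |y₀ - m| ^ (2 * (1 - γ))) / (4 * (1 - γ) * t) *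
                M'⁻¹.toReal))) ∧
        ENNReal.ofReal A / (2 * M' * t * ENNReal.ofReal (1 + |y| ^ γ)) *
            ENNReal.ofReal (Real.exp
              (-((|y - m| ^ (2 * (p + 1)) - |y₀ - m| ^ (2 * (p + 1))) / (t * (p + 1)) *
                M⁻¹.toReal))) *
            ENNReal.ofReal (Real.exp
              (-(|y₀ - m| ^ 2 / t * (1 + y₀ ^ (2 * p)) * M⁻¹.toReal))) ≤
          (imageDensity t (v t) y : ℝ≥0∞) := by
  let M : ℝ≥0∞ := constM T t v K αt ε'
  let M' : ℝ≥0∞ := constM' T t v ε ε'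
  let p : ℝ := αt * ((upperRate (spaceInv v t)).toReal + ε')
  set a := (upperRate (spaceDeriv v t)).toReal with ha_def
  set b := (upperRate (spaceInv v t)).toReal with hb_def
  have ha : 0 ≤ a := ENNReal.toReal_nonneg
  have hb : 0 ≤ b := ENNReal.toReal_nonneg
  have hp : 0 < p := by positivity
  -- An exponent `e > a` for the derivative that still satisfies `(1 - γ) (1 + e) < 1`.
  obtain ⟨e, hae, he⟩ : ∃ e, a < e ∧ (e + 1) * (2 * (1 - γ)) < 2 := by
    have h1 : 1 + a < (1 - γ)⁻¹ := by
      rw [← one_div, lt_div_iff₀ (sub_pos.2 hγ), mul_comm]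
      exact hγa
    obtain ⟨e', h2, h3⟩ := exists_between h1
    refine ⟨e' - 1, by linarith, ?_⟩
    rw [← one_div, lt_div_iff₀ (sub_pos.2 hγ)] at h3
    linarith
  have he0 : 0 ≤ e := ha.trans hae.le
  have hder : GrowthLE (deriv (v t)) e := growthLE_of_upperRate_lt hf.cont_deriv hup hae
  have hval : GrowthLE (v t) (e + 1) :=
    .of_hasDerivAt he0 (fun x ↦ (hf.diff x).hasDerivAt) hder
  have hinv' : GrowthLE (fun x ↦ 1 / deriv (v t) x) αt :=
    ⟨K, hK, fun x ↦ by rw [abs_of_pos (one_div_pos.2 (hf.pos x))]; exact hinv x⟩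
  have hg : GrowthLE (Function.invFun (v t)) (b + ε' / 2) :=
    growthLE_of_upperRate_lt hf.continuous_invFun hupinv (by linarith : b < b + ε' / 2)
  -- The derivative of the inverse is `1 / v' ∘ v⁻¹`, of growth at most `p - αt ε' / 2`.
  have hg' : GrowthLE (Function.invFun (v t)) ((b + ε' / 2) * αt + 1) :=
    .of_hasDerivAt (by positivity) (fun y ↦ by simpa using hf.hasDerivAt_invFun y)
      (hinv'.comp hg hαt.le)
  have hgp : (b + ε' / 2) * αt + 1 < p + 1 := by
    have := mul_pos hαt hε'
    simp only [p]
    linarith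
  have hU := hf.eventually_upper_bound ht0.ne' (p := p) (γ := γ) (A := A) m (M := M) (M' := M') hinv' hval
    hαt.le (by linarith) hγ he hA (constM_ne_top _ _ _ hK _ _)
  have hL := hf.eventually_lower_bound ht0.ne' (γ := γ) (A := A) m (M := M) (M' := M') hder hg' he0
    (by positivity) hp hgp hA (constM_ne_top _ _ _ hK _ _) (constM'_ne_zero ht hf.pos hε _)
    (constM'_eq_top_of_constM_eq_zero ht hf.pos hαt hε)
  obtain ⟨R, hR⟩ := eventually_atTop.1 (eventually_comap.1 (hU.and hL))
  obtain ⟨y₀, h1, h2, h3⟩ := ((IsIncreasingDiffeo.eventually_abs_sub_rpow_le m hp).and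
    ((eventually_gt_atTop 0).and (eventually_ge_atTop R))).exists
  exact ⟨y₀, h2, fun y hy ↦ ⟨(hR |y| (h3.trans hy.le) y rfl).1 y₀,
    (hR |y| (h3.trans hy.le) y rfl).2 y₀ h1⟩⟩

end DensityTails

theorem mainTheorem9 {Ω : Type*} [MeasurableSpace Ω] (P : Measure Ω) [IsProbabilityMeasure P]
    (T t : ℝ≥0) (ht : 0 < t) (htT : t ≤ T)
    (W : ℝ≥0 → Ω → ℝ) (hW : DensityTails.IsBrownianUpTo T W P)
    (v : ℝ → ℝ → ℝ) (hv : DensityTails.IsC11 T v)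
    (hint : Integrable (fun ω ↦ v t (W t ω)) P)
    (hunb : ∀ s ∈ Set.Icc (0 : ℝ) T,
      ¬ BddAbove (Set.range (v s)) ∧ ¬ BddBelow (Set.range (v s)))
    (hpos : ∀ s ∈ Set.Icc (0 : ℝ) T, ∀ x, 0 < DensityTails.spaceDeriv v s x)
    (hlow_pos : 0 < DensityTails.lowerRate (v t))
    (hlow_fin : DensityTails.lowerRate (v t) < ⊤)
    (hup_fin : DensityTails.upperRate (DensityTails.spaceDeriv v t) < ⊤)
    (K αt : ℝ) (hK : 0 < K) (hαt : 0 < αt)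
    (hinv : ∀ x : ℝ, 1 / DensityTails.spaceDeriv v t x ≤ K * (1 + |x| ^ αt))
    (hlt : DensityTails.upperRate (DensityTails.spaceDeriv v t) < DensityTails.lowerRate (v t)) :
    DensityTails.upperRate (DensityTails.spaceInv v t) < ⊤ ∧
    ∃ ρ : ℝ → ℝ≥0, Continuous ρ ∧
      P.map (fun ω ↦ v t (W t ω)) = volume.withDensity (fun y ↦ (ρ y : ℝ≥0∞)) ∧
      ∃ ε₀ ε₀' y₀ γ : ℝ, 0 < ε₀ ∧ 0 < ε₀' ∧ 0 < y₀ ∧ γ ∈ Set.Ioo (0 : ℝ) 1 ∧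
        let m : ℝ := ∫ ω, v t (W t ω) ∂P
        let A : ℝ := ∫ ω, |v t (W t ω) - m| ∂P
        let M : ℝ≥0∞ := DensityTails.constM T t v K αt ε₀'
        let M' : ℝ≥0∞ := DensityTails.constM' T t v ε₀ ε₀'
        let p : ℝ := αt * ((DensityTails.upperRate (DensityTails.spaceInv v t)).toReal + ε₀')
        ∀ y : ℝ, y₀ < |y| →
          (ρ y : ℝ≥0∞) ≤
              ENNReal.ofReal A / (2 * M * t) * ENNReal.ofReal (1 + |y| ^ (2 * p)) *
                ENNReal.ofReal (Real.exp
                  (-((|y - m| ^ (2 * (1 - γ)) - |y₀ - m| ^ (2 * (1 - γ))) / (4 * (1 - γ) * t) *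
                    M'⁻¹.toReal))) ∧
          ENNReal.ofReal A / (2 * M' * t * ENNReal.ofReal (1 + |y| ^ γ)) *
                ENNReal.ofReal (Real.exp
                  (-((|y - m| ^ (2 * (p + 1)) - |y₀ - m| ^ (2 * (p + 1))) / (t * (p + 1)) *
                    M⁻¹.toReal))) *
                ENNReal.ofReal (Real.exp
                  (-(|y₀ - m| ^ 2 / t * (1 + y₀ ^ (2 * p)) * M⁻¹.toReal))) ≤
              (ρ y : ℝ≥0∞) := by

  have htI : (t : ℝ) ∈ Icc (0 : ℝ) T := ⟨t.2, by exact_mod_cast htT⟩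
  have hf := hv.isIncreasingDiffeo htI (hpos t htI) (hunb t htI)
  have hfin : DensityTails.upperRate (DensityTails.spaceInv v t) < ⊤ :=
    hf.upperRate_invFun_lt_top hlow_pos
  have hlaw := hW.hasLaw_eval htT
  have hmap : P.map (fun ω ↦ v t (W t ω)) =
      volume.withDensity (fun y ↦ (DensityTails.imageDensity t (v t) y : ℝ≥0∞)) := by
    rw [← hf.map_gaussianReal ht.ne', ← hlaw.map_eq,
      AEMeasurable.map_map_of_aemeasurable hf.diff.continuous.aemeasurable hlaw.aemeasurable]
    rfl
  set a := (DensityTails.upperRate (DensityTails.spaceDeriv v t)).toReal with ha_def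
  have ha : 0 ≤ a := ENNReal.toReal_nonneg
  -- Any `ε₀, ε₀' > 0` will do; `(1 - γ) (1 + a) < 1` holds for `1 - γ = 1 / (2 + a)`.
  have hγ0 : 0 < 1 / (2 + a) := by positivity
  have hγ1 : 1 / (2 + a) < 1 := by
    rw [div_lt_one (by positivity)]
    linarith
  have hγa : (1 - (1 - 1 / (2 + a))) * (1 + a) < 1 := by
    rw [sub_sub_cancel, one_div_mul_eq_div, div_lt_one (by positivity)]
    linarith
  obtain ⟨y₀, hy₀, H⟩ := DensityTails.exists_threshold ht htI hf hup_fin hfin hK hαt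
    hinv one_pos one_pos (γ := 1 - 1 / (2 + a)) (by linarith) hγa
    (DensityTails.integral_abs_sub_pos hint hmap (∫ ω, v t (W t ω) ∂P)) (∫ ω, v t (W t ω) ∂P)
  exact ⟨hfin, DensityTails.imageDensity t (v t), hf.continuous_imageDensity t, hmap,
    1, 1, y₀, 1 - 1 / (2 + a), one_pos, one_pos, hy₀, ⟨by linarith, by linarith⟩, H⟩
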